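/- Let $(\mathcal X,\mathsf d)$ be a separable metric space with Borel $\sigma$-algebra $\mathfrak B(\mathcal X)$, let $\mu$ be a probability measure on $\mathcal X\times\{0,1\}$ with first marginal $\rho$, and let $\varepsilon>0$. Put $w_i=\mu(\mathcal X\times\{i\})$ and $\rho_i(A)=\mu(A\times\{i\})/w_i$ for $i\in\{0,1\}$ (a term carrying the factor $w_i$ is $0$ if $w_i=0$), and write $B_r(x)$ for open balls, $\mathsf{dist}(x,A)=\inf_{a\in A}\mathsf d(x,a)$ with $\mathsf{dist}(x,\emptyset)=\infty$. Let $\nu$ be a finite Borel measure on $\mathcal X$ such that $\rho\ll\nu$, $\{x:\mathsf{dist}(x,\operatorname{supp}\rho)<\varepsilon\}\subseteq\operatorname{supp}\nu$, and $\limsup_{r\downarrow0}\nu(B_{2r}(x))/\nu(B_r(x))<\infty$ for $\nu$-a.e. $x$. *Problems.* The adversarial problem is $$\inf_{A\in\mathfrak B(\mathcal X)}\ \mathbb E_{(x,y)\sim\mu}\Big[\sup_{\tilde x\in B_\varepsilon(x)}|1_A(\tilde x)-y|\Big].\tag{1}$$ Write $A\sim_\nu B$ if $\nu(A\triangle B)=0$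 and $A\preceq_\nu B$ if $1_A\le1_B$ $\nu$-a.e., and set $$\widetilde{\operatorname{Per}}_\varepsilon(A)=\frac{w_0}{\varepsilon}\int\Big(\sup_{B_\varepsilon(x)}1_A-1_A(x)\Big)d\rho_0(x)+\frac{w_1}{\varepsilon}\int\Big(1_A(x)-\inf_{B_\varepsilon(x)}1_A\Big)d\rho_1(x),$$ $\operatorname{Per}^\nu_\varepsilon(A)=\inf\{\widetilde{\operatorname{Per}}_\varepsilon(B):B\in\mathfrak B(\mathcal X),\,B\sim_\nu A\}$. The regularized problem is $$\inf_{A\in\mathfrak B(\mathcal X)}\ \mathbb E_{(x,y)\sim\mu}|1_A(x)-y|+\varepsilon\operatorname{Per}^\nu_\varepsilon(A).\tag{2}$$ Solutions are Borel sets attaining the infimum. A solution $A$ of (2) is maximal (minimal) if every solution $A'$ of (2) with $A\preceq_\nu A'$ ($A'\preceq_\nu A$) satisfies $A\sim_\nu A'$. *Representatives and morphology.* For Borel $A$ let $$A^+=\Big\{x\in\operatorname{supp}\nu:\limsup_{r\downarrow0}\tfrac{\nu(B_r(x)\cap A)}{\nu(B_r(x))}>0\Big\}\cup(\mathcal X\setminus\operatorname{supp}\nu),\qquad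 A^-=\Big\{x\in\operatorname{supp}\nu:\liminf_{r\downarrow0}\tfrac{\nu(B_r(x)\cap A)}{\nu(B_r(x))}=1\Big\}.$$ For $A\subseteq\mathcal X$ let $A^{\varepsilon}=\{x:\mathsf{dist}(x,A)<\varepsilon\}$, $A^{-\varepsilon}=\{x:\mathsf{dist}(x,A^c)\ge\varepsilon\}$, $\operatorname{cl}_\varepsilon(A)=(A^\varepsilon)^{-\varepsilon}$, $\operatorname{op}_\varepsilon(A)=(A^{-\varepsilon})^\varepsilon$. The set $A$ is called $\varepsilon$ inner (outer) regular if for every $x\in\partial A$ there is $y\in\mathcal X$ with $\mathsf d(x,y)=\varepsilon$ and $B_\varepsilon(y)\subseteq A$ ($B_\varepsilon(y)\subseteq A^c$). *Claim.* Problem (2) has a maximal solution and a minimal solution, and there exist two solutions $A'_+$ and $A'_-$ of the adversarial problem (1) with the following properties: 1. $A'_-\subseteq A'_+$. 2. $A'_+$ is closed and $A'_-$ is open. 3. Suppose that distances equal to $\varepsilon$ are attained in $\mathcal X$, i.e. for every $x\in\mathcal X$ and every closed $C\subseteq\mathcal X$ with $\mathsf{dist}(x,C)=\varepsilon$ there is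 $y\in C$ with $\mathsf d(x,y)=\varepsilon$ (this holds whenever closed bounded subsets of $\mathcal X$ are compact, e.g. in $\mathbb R^d$ with an $\ell^p$-metric). Then $A'_+$ is $\varepsilon$ outer regular and $A'_-$ is $\varepsilon$ inner regular. 4. For every maximal solution $A_{\max}$ and every minimal solution $A_{\min}$ of (2): $A_{\max}\sim_\nu A'_+$ and $A_{\min}\sim_\nu A'_-$; moreover $A'_+=\operatorname{cl}_\varepsilon(A_{\max}^+)$ and $A'_-=\operatorname{op}_\varepsilon(A_{\min}^-)$. -/

import Mathlib

namespace AdvTraining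

noncomputable section

open MeasureTheory Set Filter
open scoped ENNReal Topology symmDiff

variable {X : Type*} [MetricSpace X] [MeasurableSpace X]

/-! ### Data distribution

`μ` is the distribution of pairs `(x, y)` of a feature `x : X` and a label `y ∈ {0, 1}`. -/

/-- The first marginal of `μ`, i.e. the distribution of the input data. -/
def dataMarginal (μ : Measure (X × Fin 2)) : Measure X := μ.map Prod.fst

/-- The class probability `w_i = μ (X × {i})`. -/
def classWeight (μ : Measure (X × Fin 2)) (i : Fin 2) : ℝ≥0∞ := μ (Prod.snd ⁻¹' {i})

/-- The conditional distribution `ρ_i (A) = μ (A × {i}) / w_i` of the features given the label. -/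
def classDist (μ : Measure (X × Fin 2)) (i : Fin 2) : Measure X :=
  (ProbabilityTheory.cond μ (Prod.snd ⁻¹' {i})).map Prod.fst

/-- The indicator function `1_A`, with values in `[0, ∞]`. -/
def ind (A : Set X) (x : X) : ℝ≥0∞ := A.indicator 1 x

/-- The zero-one loss `|1_A(x) - y|`, as an extended nonnegative number. -/
def loss (A : Set X) (x : X) (y : Fin 2) : ℝ≥0∞ :=
  ENNReal.ofReal |A.indicator (1 : X → ℝ) x - ((y : ℕ) : ℝ)|

/-! ### The adversarial problem -/

/-- The adversarial risk `E_{(x,y) ∼ μ} [ sup_{x' ∈ B_ε(x)} |1_A(x') - y| ]`, with open balls. -/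
def advRisk (ε : ℝ) (μ : Measure (X × Fin 2)) (A : Set X) : ℝ≥0∞ :=
  ∫⁻ z, ⨆ x' ∈ Metric.ball z.1 ε, loss A x' z.2 ∂μ

/-- `A` is a solution of the adversarial problem: a Borel set that minimizes the adversarial risk
among all Borel sets. -/
def IsAdvSolution (ε : ℝ) (μ : Measure (X × Fin 2)) (A : Set X) : Prop :=
  MeasurableSet A ∧ ∀ B : Set X, MeasurableSet B → advRisk ε μ A ≤ advRisk ε μ B

/-! ### The perimeter-regularized problem -/

/-- The equivalence `A ∼_ν B`, i.e. `ν (A ∆ B) = 0`. -/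
def NuEquiv (ν : Measure X) (A B : Set X) : Prop := ν (A ∆ B) = 0

/-- The preorder `A ≼_ν B`, i.e. `1_A ≤ 1_B` holds `ν`-almost everywhere. -/
def NuLE (ν : Measure X) (A B : Set X) : Prop := ∀ᵐ x ∂ν, ind A x ≤ ind B x

/-- The nonlocal pre-perimeter
`(w₀/ε) ∫ (sup_{B_ε(x)} 1_A - 1_A(x)) dρ₀(x) + (w₁/ε) ∫ (1_A(x) - inf_{B_ε(x)} 1_A) dρ₁(x)`.
Both integrands are nonnegative for `ε > 0`, so that the subtraction of `ℝ≥0∞` is the usual one. -/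
def prePerimeter (ε : ℝ) (μ : Measure (X × Fin 2)) (A : Set X) : ℝ≥0∞ :=
  classWeight μ 0 / ENNReal.ofReal ε *
      ∫⁻ x, ((⨆ x' ∈ Metric.ball x ε, ind A x') - ind A x) ∂(classDist μ 0)
    + classWeight μ 1 / ENNReal.ofReal ε *
      ∫⁻ x, (ind A x - ⨅ x' ∈ Metric.ball x ε, ind A x') ∂(classDist μ 1)

/-- The nonlocal perimeter with respect to `ν`: the infimum of the pre-perimeter over all Borel
sets that are `ν`-equivalent to `A`. -/
def perimeter (ν : Measure X) (ε : ℝ) (μ : Measure (X × Fin 2)) (A : Set X) : ℝ≥0∞ :=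
  ⨅ (B : Set X) (_ : MeasurableSet B) (_ : NuEquiv ν A B), prePerimeter ε μ B

/-- The objective `E_{(x,y) ∼ μ} |1_A(x) - y| + ε Per_ε(A; μ)`. -/
def perRisk (ν : Measure X) (ε : ℝ) (μ : Measure (X × Fin 2)) (A : Set X) : ℝ≥0∞ :=
  ∫⁻ z, loss A z.1 z.2 ∂μ + ENNReal.ofReal ε * perimeter ν ε μ A

/-- `A` is a solution of the perimeter-regularized problem. -/
def IsPerSolution (ν : Measure X) (ε : ℝ) (μ : Measure (X × Fin 2)) (A : Set X) : Prop :=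
  MeasurableSet A ∧ ∀ B : Set X, MeasurableSet B → perRisk ν ε μ A ≤ perRisk ν ε μ B

/-- `A` is a maximal solution of the perimeter-regularized problem. -/
def IsMaxPerSolution (ν : Measure X) (ε : ℝ) (μ : Measure (X × Fin 2)) (A : Set X) : Prop :=
  IsPerSolution ν ε μ A ∧ ∀ A' : Set X, IsPerSolution ν ε μ A' → NuLE ν A A' → NuEquiv ν A A'

/-- `A` is a minimal solution of the perimeter-regularized problem. -/
def IsMinPerSolution (ν : Measure X) (ε : ℝ) (μ : Measure (X × Fin 2)) (A : Set X) : Prop :=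
  IsPerSolution ν ε μ A ∧ ∀ A' : Set X, IsPerSolution ν ε μ A' → NuLE ν A' A → NuEquiv ν A A'

/-- The standing assumption on the reference measure `ν` (which is moreover finite): the data
distribution is absolutely continuous with respect to `ν`, the open `ε`-neighbourhood of its
support lies in the support of `ν`, and `ν` is locally doubling at `ν`-almost every point. -/
structure IsReferenceMeasure (ν : Measure X) (ε : ℝ) (μ : Measure (X × Fin 2)) : Prop where
  absolutelyContinuous : dataMarginal μ ≪ ν
  thickening_subset : Metric.thickening ε (dataMarginal μ).support ⊆ ν.support
  locallyDoubling : ∀ᵐ x ∂ν,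
    limsup (fun r : ℝ => ν (Metric.ball x (2 * r)) / ν (Metric.ball x r)) (𝓝[>] 0) < ∞

/-! ### Density-based representatives -/

/-- The representative `A⁺`: points outside the support of `ν` and points of the support at which
the upper density of `A` is positive. -/
def upperRep (ν : Measure X) (A : Set X) : Set X :=
  {x | x ∈ ν.support →
    0 < limsup (fun r : ℝ => ν (Metric.ball x r ∩ A) / ν (Metric.ball x r)) (𝓝[>] 0)}

/-- The representative `A⁻`: points of the support of `ν` at which the lower density of `A` is
one. -/
def lowerRep (ν : Measure X) (A : Set X) : Set X :=
  {x | x ∈ ν.support ∧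
    liminf (fun r : ℝ => ν (Metric.ball x r ∩ A) / ν (Metric.ball x r)) (𝓝[>] 0) = 1}

/-! ### Morphology

The dilation `{x | dist (x, A) < ε}` is `Metric.thickening ε A`; the distance to the empty set
is `∞`. -/

/-- The erosion `{x | dist (x, Aᶜ) ≥ ε}`. -/
def erosion (ε : ℝ) (A : Set X) : Set X := {x | ENNReal.ofReal ε ≤ Metric.infEDist x Aᶜ}

/-- The morphological closing: dilation followed by erosion. -/
def closing (ε : ℝ) (A : Set X) : Set X := erosion ε (Metric.thickening ε A)

/-- The morphological opening: erosion followed by dilation. -/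
def opening (ε : ℝ) (A : Set X) : Set X := Metric.thickening ε (erosion ε A)

/-- `ε` inner regularity relative to the metric. -/
def InnerRegularAt (ε : ℝ) (A : Set X) : Prop :=
  ∀ x ∈ frontier A, ∃ y : X, dist x y = ε ∧ Metric.ball y ε ⊆ A

/-- `ε` outer regularity relative to the metric. -/
def OuterRegularAt (ε : ℝ) (A : Set X) : Prop :=
  ∀ x ∈ frontier A, ∃ y : X, dist x y = ε ∧ Metric.ball y ε ⊆ Aᶜ

/-- Whenever a point has distance exactly `ε` to a closed set, this distance is attained. This
holds for every `ε` in a space whose closed bounded sets are compact, such as `ℝ^d`. -/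
def AttainsDistance (X : Type*) [MetricSpace X] (ε : ℝ) : Prop :=
  ∀ (x : X) (C : Set X), IsClosed C → Metric.infEDist x C = ENNReal.ofReal ε →
    ∃ y ∈ C, dist x y = ε

end

end AdvTraining

namespace AdvTraining

noncomputable section

open MeasureTheory Set Filter
open scoped ENNReal Topology symmDiff

/-! ### The loss and null sets -/

section ClassMeasure

variable {X : Type*}

/-! Let m₀, m₁ be the parts of the data distribution with labels 0 and 1. Replace the dilation of a
set by its essential dilation: the points whose open ε-ball meets the set in positive ν-measure. The
m₀-mass of the essential dilation of A plus the m₁-mass of that of Aᶜ, `essRisk`, depends only on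
the ν-class of A and never exceeds the adversarial risk, while `exists_nuEquiv_classRisk_le` finds a
representative whose adversarial risk is no larger. Hence the regularized problem is the
minimization of `essRisk` (`perRisk_eq_essRisk`).

`essRisk` is submodular and bounds on it survive monotone limits, so minimizers exist and are stable
under countable unions. A minimizer of largest ν-measure contains all others up to null sets and is
the maximal solution; complements, which swap m₀ and m₁, give the minimal one.

For a greatest minimizer A, local doubling and a Vitali covering (`measure_diff_upperRep`) put
almost all of A into A⁺, and then `classRisk_closing_upperRep_le` bounds the adversarial risk of
cl_ε(A⁺) by the essential risk of A. So the closing solves the adversarial problem. It is also an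
essential minimizer containing A a.e., hence equivalent to A. -/

lemma loss_zero (A : Set X) (x : X) : loss A x 0 = A.indicator 1 x := by
  by_cases h : x ∈ A <;> simp [loss, h]

lemma loss_one (A : Set X) (x : X) : loss A x 1 = Aᶜ.indicator 1 x := by
  by_cases h : x ∈ A <;> simp [loss, h]

variable [MeasurableSpace X] {ν : Measure X} {A B : Set X} {μ : Measure (X × Fin 2)}

lemma measure_congr_of_nuEquiv {m : Measure X} (hm : m ≪ ν) (h : NuEquiv ν A B) : m A = m B :=
  measure_congr (measure_symmDiff_eq_zero_iff.1 (hm h))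

lemma NuEquiv.compl (h : NuEquiv ν A B) : NuEquiv ν Aᶜ Bᶜ := by
  rwa [NuEquiv, compl_symmDiff_compl]

/-! ### The class measures of the data distribution -/

/-- The part of the data distribution with label `i`, i.e. `w_i ρ_i`. -/
def classMeasure (μ : Measure (X × Fin 2)) (i : Fin 2) : Measure X :=
  (μ.restrict (Prod.snd ⁻¹' {i})).map Prod.fst

instance [IsFiniteMeasure μ] (i : Fin 2) : IsFiniteMeasure (classMeasure μ i) := by
  unfold classMeasure
  infer_instance

lemma classMeasure_le_dataMarginal (i : Fin 2) : classMeasure μ i ≤ dataMarginal μ :=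
  Measure.map_mono Measure.restrict_le_self measurable_fst

lemma classWeight_smul_classDist [IsFiniteMeasure μ] (i : Fin 2) :
    classWeight μ i • classDist μ i = classMeasure μ i := by
  rw [classDist, ProbabilityTheory.cond, Measure.map_smul, smul_smul, classWeight, classMeasure]
  by_cases h : μ (Prod.snd ⁻¹' {i}) = 0
  · simp [Measure.restrict_eq_zero.2 h]
  · rw [ENNReal.mul_inv_cancel h (measure_ne_top _ _), one_smul]

/-- The data distribution splits into its class measures. -/
lemma lintegral_eq_add_classMeasure {f : X × Fin 2 → ℝ≥0∞} {g₀ g₁ : X → ℝ≥0∞}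
    (hf₀ : ∀ x, f (x, 0) = g₀ x) (hf₁ : ∀ x, f (x, 1) = g₁ x)
    (hg₀ : Measurable g₀) (hg₁ : Measurable g₁) :
    ∫⁻ z, f z ∂μ = ∫⁻ x, g₀ x ∂(classMeasure μ 0) + ∫⁻ x, g₁ x ∂(classMeasure μ 1) := by
  have hm (i : Fin 2) : MeasurableSet (Prod.snd ⁻¹' {i} : Set (X × Fin 2)) :=
    measurable_snd (measurableSet_singleton i)
  have hc : (Prod.snd ⁻¹' {0} : Set (X × Fin 2))ᶜ = Prod.snd ⁻¹' {1} := by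
    ext ⟨x, y⟩
    fin_cases y <;> simp
  rw [← lintegral_add_compl f (hm 0), hc, classMeasure, classMeasure,
    lintegral_map hg₀ measurable_fst, lintegral_map hg₁ measurable_fst]
  congr 1
  · refine setLIntegral_congr_fun (hm 0) fun z hz => ?_
    obtain ⟨x, y⟩ := z
    obtain rfl : y = 0 := hz
    exact hf₀ x
  · refine setLIntegral_congr_fun (hm 1) fun z hz => ?_
    obtain ⟨x, y⟩ := z
    obtain rfl : y = 1 := hz
    exact hf₁ x

lemma lintegral_loss (hA : MeasurableSet A) :
    ∫⁻ z, loss A z.1 z.2 ∂μ = classMeasure μ 0 A + classMeasure μ 1 Aᶜ := by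
  rw [lintegral_eq_add_classMeasure (g₀ := A.indicator 1) (g₁ := Aᶜ.indicator 1)
    (loss_zero A) (loss_one A) (measurable_one.indicator hA) (measurable_one.indicator hA.compl),
    lintegral_indicator_one hA, lintegral_indicator_one hA.compl]

lemma nuLE_iff : NuLE ν A B ↔ ν (A \ B) = 0 := by
  rw [NuLE, ae_iff]
  congr! 2
  ext x
  by_cases hA : x ∈ A <;> by_cases hB : x ∈ B <;> simp [ind, hA, hB]

end ClassMeasure

/-! ### Morphology -/

section Morphology

variable {X : Type*} [MetricSpace X] {ε : ℝ} {A : Set X}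

lemma erosion_eq_compl_thickening (ε : ℝ) (A : Set X) :
    erosion ε A = (Metric.thickening ε Aᶜ)ᶜ := by
  ext x
  simp [erosion, Metric.mem_thickening_iff_infEDist_lt]

lemma closing_eq (ε : ℝ) (A : Set X) :
    closing ε A = (Metric.thickening ε (Metric.thickening ε A)ᶜ)ᶜ :=
  erosion_eq_compl_thickening _ _

lemma opening_compl (ε : ℝ) (A : Set X) : opening ε Aᶜ = (closing ε A)ᶜ := by
  rw [closing_eq, opening, erosion_eq_compl_thickening, compl_compl, compl_compl]

lemma isClosed_closing (ε : ℝ) (A : Set X) : IsClosed (closing ε A) := by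
  rw [closing_eq]
  exact Metric.isOpen_thickening.isClosed_compl

lemma subset_closing (ε : ℝ) (A : Set X) : A ⊆ closing ε A := by
  intro x hx
  rw [closing_eq, mem_compl_iff, Metric.mem_thickening_iff]
  rintro ⟨z, hz, hxz⟩
  exact hz (Metric.mem_thickening_iff.2 ⟨x, hx, by rwa [dist_comm]⟩)

lemma opening_subset (ε : ℝ) (A : Set X) : opening ε A ⊆ A := by
  rw [← compl_compl A, opening_compl]
  exact compl_subset_compl.2 (subset_closing ε _)

/-- Every point of the closing has its whole open ε-ball inside the dilation of A, so closing costs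
nothing in dilation. -/
lemma thickening_closing (ε : ℝ) (A : Set X) :
    Metric.thickening ε (closing ε A) = Metric.thickening ε A := by
  refine Subset.antisymm ?_ (Metric.thickening_subset_of_subset ε (subset_closing ε A))
  intro x hx
  obtain ⟨z, hz, hxz⟩ := Metric.mem_thickening_iff.1 hx
  by_contra hxA
  rw [closing_eq] at hz
  exact hz (Metric.mem_thickening_iff.2 ⟨x, hxA, by rwa [dist_comm]⟩)

/-- The closing is a superlevel set of the distance to the complement of the dilation, so by
continuity this distance is exactly ε on the frontier. The point attaining it lies outside the
dilation, and its open ε-ball misses the closing. -/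
lemma AttainsDistance.outerRegularAt_closing (h : AttainsDistance X ε) (A : Set X) :
    OuterRegularAt ε (closing ε A) := by
  intro x hx
  have hmem {z : X} : z ∈ closing ε A ↔
      ENNReal.ofReal ε ≤ Metric.infEDist z (Metric.thickening ε A)ᶜ := Iff.rfl
  have hle : ENNReal.ofReal ε ≤ Metric.infEDist x (Metric.thickening ε A)ᶜ :=
    hmem.1 ((isClosed_closing ε A).frontier_subset hx)
  have hge : Metric.infEDist x (Metric.thickening ε A)ᶜ ≤ ENNReal.ofReal ε := by
    have hcl : IsClosed {z | Metric.infEDist z (Metric.thickening ε A)ᶜ ≤ ENNReal.ofReal ε} :=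
      isClosed_le Metric.continuous_infEDist continuous_const
    refine closure_minimal (s := (closing ε A)ᶜ) (fun z hz => ?_) hcl ?_
    · exact (not_le.1 (mt hmem.2 hz)).le
    · rw [← frontier_compl] at hx
      exact frontier_subset_closure hx
  obtain ⟨y, hy, hxy⟩ := h x _ Metric.isOpen_thickening.isClosed_compl (hge.antisymm hle)
  refine ⟨y, hxy, fun z hz => ?_⟩
  rw [closing_eq, compl_compl]
  exact Metric.mem_thickening_iff.2 ⟨y, hy, hz⟩

lemma OuterRegularAt.innerRegularAt_compl (h : OuterRegularAt ε A) : InnerRegularAt ε Aᶜ :=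
  fun x hx => h x (by rwa [frontier_compl] at hx)

lemma iSup_ball_indicator (ε : ℝ) (A : Set X) (x : X) :
    ⨆ x' ∈ Metric.ball x ε, A.indicator (1 : X → ℝ≥0∞) x' =
      (Metric.thickening ε A).indicator 1 x := by
  by_cases h : x ∈ Metric.thickening ε A
  · obtain ⟨y, hy, hxy⟩ := Metric.mem_thickening_iff.1 h
    rw [indicator_of_mem h]
    refine le_antisymm (iSup₂_le fun z _ => indicator_le_self' (by simp) z) ?_
    refine le_trans ?_ (le_iSup₂ y (by rwa [Metric.mem_ball, dist_comm]))
    simp [hy]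
  · rw [indicator_of_notMem h]
    refine nonpos_iff_eq_zero.1 (iSup₂_le fun z hz => ?_)
    rw [indicator_of_notMem]
    exact fun hzA => h (Metric.mem_thickening_iff.2 ⟨z, hzA, by rwa [dist_comm]⟩)

end Morphology

variable {X : Type*} [MetricSpace X] [MeasurableSpace X]
variable {ν m₀ m₁ : Measure X} {ε : ℝ} {A B : Set X} {μ : Measure (X × Fin 2)}

/-! ### The essential dilation -/

/-- The essential dilation of `A`: the points whose open `ε`-ball meets `A` in a set of positive
`ν`-measure. -/
def essThickening (ν : Measure X) (ε : ℝ) (A : Set X) : Set X :=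
  {x | ν (Metric.ball x ε ∩ A) ≠ 0}

/-- An open ball is a countable union of smaller concentric balls, one of which already meets A in
positive measure. Balls around nearby centres still contain that smaller ball. -/
lemma isOpen_essThickening : IsOpen (essThickening ν ε A) := by
  rw [Metric.isOpen_iff]
  intro x hx
  have hunion : Metric.ball x ε ∩ A = ⋃ n : ℕ, Metric.ball x (ε - 1 / ((n : ℝ) + 1)) ∩ A := by
    rw [← iUnion_inter]
    congr 1
    ext y
    simp only [Metric.mem_ball, mem_iUnion]
    constructor
    · intro hy
      obtain ⟨n, hn⟩ := exists_nat_one_div_lt (sub_pos.2 hy)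
      exact ⟨n, by linarith⟩
    · rintro ⟨n, hn⟩
      have : (0 : ℝ) < 1 / ((n : ℝ) + 1) := by positivity
      linarith
  obtain ⟨n, hn⟩ : ∃ n : ℕ, ν (Metric.ball x (ε - 1 / ((n : ℝ) + 1)) ∩ A) ≠ 0 := by
    by_contra! h
    exact hx (by rw [hunion]; exact measure_iUnion_null h)
  refine ⟨1 / ((n : ℝ) + 1), by positivity, fun y hy h0 => hn (measure_mono_null ?_ h0)⟩
  refine inter_subset_inter_left _ (Metric.ball_subset_ball' ?_)
  rw [Metric.mem_ball, dist_comm] at hy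
  linarith

lemma essThickening_mono_ae (h : ν (A \ B) = 0) :
    essThickening ν ε A ⊆ essThickening ν ε B := by
  intro x hx h0
  refine hx (measure_mono_null ?_ (measure_union_null h0 h))
  rintro y ⟨hy, hyA⟩
  by_cases hyB : y ∈ B
  · exact Or.inl ⟨hy, hyB⟩
  · exact Or.inr ⟨hyA, hyB⟩

lemma essThickening_mono (h : A ⊆ B) : essThickening ν ε A ⊆ essThickening ν ε B :=
  essThickening_mono_ae (by simp [sdiff_eq_empty.2 h])

/-- A countable union is null exactly when each of its members is. -/
lemma essThickening_iUnion {ι : Type*} [Countable ι] (s : ι → Set X) :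
    essThickening ν ε (⋃ i, s i) = ⋃ i, essThickening ν ε (s i) := by
  ext x
  simp only [essThickening, mem_ofPred_eq, inter_iUnion, mem_iUnion, ne_eq, measure_iUnion_null_iff,
    not_forall]

lemma essThickening_union :
    essThickening ν ε (A ∪ B) = essThickening ν ε A ∪ essThickening ν ε B := by
  rw [union_eq_iUnion, essThickening_iUnion, union_eq_iUnion]
  congr 1
  ext b
  cases b <;> rfl

lemma essThickening_subset_thickening : essThickening ν ε A ⊆ Metric.thickening ε A := by
  intro x hx
  obtain ⟨y, hy, hyA⟩ := nonempty_of_measure_ne_zero hx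
  exact Metric.mem_thickening_iff.2 ⟨y, hyA, by rwa [dist_comm]⟩

/-! ### The essential risk -/

/-- The essential adversarial risk, for the class measures `m₀` and `m₁`. -/
def essRisk (ν m₀ m₁ : Measure X) (ε : ℝ) (A : Set X) : ℝ≥0∞ :=
  m₀ (essThickening ν ε A) + m₁ (essThickening ν ε Aᶜ)

lemma essRisk_compl : essRisk ν m₁ m₀ ε Aᶜ = essRisk ν m₀ m₁ ε A := by
  simp [essRisk, add_comm]

lemma essRisk_congr (h : NuEquiv ν A B) : essRisk ν m₀ m₁ ε A = essRisk ν m₀ m₁ ε B := by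
  have h1 : ν (A \ B) = 0 := measure_mono_null subset_union_left h
  have h2 : ν (B \ A) = 0 := measure_mono_null subset_union_right h
  have hc (s t : Set X) : sᶜ \ tᶜ = t \ s := by ext; simp [and_comm]
  rw [essRisk, essRisk, (essThickening_mono_ae h1).antisymm (essThickening_mono_ae h2),
    (essThickening_mono_ae (A := Aᶜ) (B := Bᶜ) (by rwa [hc])).antisymm
      (essThickening_mono_ae (by rwa [hc]))]

/-- Submodularity: the essential dilation commutes with unions and sends an intersection into the
intersection of the dilations. Complements exchange union and intersection, so both class terms obey
the same inequality. -/
lemma essRisk_union_add_inter_le [OpensMeasurableSpace X] (A B : Set X) :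
    essRisk ν m₀ m₁ ε (A ∪ B) + essRisk ν m₀ m₁ ε (A ∩ B)
      ≤ essRisk ν m₀ m₁ ε A + essRisk ν m₀ m₁ ε B := by
  have key (m : Measure X) (s t : Set X) :
      m (essThickening ν ε (s ∪ t)) + m (essThickening ν ε (s ∩ t))
        ≤ m (essThickening ν ε s) + m (essThickening ν ε t) := by
    rw [essThickening_union,
      ← measure_union_add_inter (essThickening ν ε s) isOpen_essThickening.measurableSet]
    gcongr
    exact subset_inter (essThickening_mono inter_subset_left)
      (essThickening_mono inter_subset_right)
  have h0 := key m₀ A B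
  have h1 := key m₁ Aᶜ Bᶜ
  rw [← compl_inter, ← compl_union] at h1
  calc essRisk ν m₀ m₁ ε (A ∪ B) + essRisk ν m₀ m₁ ε (A ∩ B)
      = (m₀ (essThickening ν ε (A ∪ B)) + m₀ (essThickening ν ε (A ∩ B)))
        + (m₁ (essThickening ν ε (A ∩ B)ᶜ) + m₁ (essThickening ν ε (A ∪ B)ᶜ)) := by
        simp only [essRisk]; ring
    _ ≤ (m₀ (essThickening ν ε A) + m₀ (essThickening ν ε B))
        + (m₁ (essThickening ν ε Aᶜ) + m₁ (essThickening ν ε Bᶜ)) := add_le_add h0 h1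
    _ = _ := by simp only [essRisk]; ring

/-- Along an increasing sequence the first term is continuous from below, and the second can only
drop because the complements shrink. -/
lemma essRisk_iUnion_le {s : ℕ → Set X} (hs : Monotone s) {c : ℝ≥0∞}
    (hc : ∀ n, essRisk ν m₀ m₁ ε (s n) ≤ c) : essRisk ν m₀ m₁ ε (⋃ n, s n) ≤ c := by
  have hmono : Monotone fun n => essThickening ν ε (s n) :=
    fun i j hij => essThickening_mono (hs hij)
  rw [essRisk, essThickening_iUnion, hmono.measure_iUnion, ENNReal.iSup_add]
  refine iSup_le fun n => le_trans ?_ (hc n)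
  rw [essRisk]
  gcongr
  exact essThickening_mono (compl_subset_compl.2 (subset_iUnion s n))

lemma essRisk_iInter_le {s : ℕ → Set X} (hs : Antitone s) {c : ℝ≥0∞}
    (hc : ∀ n, essRisk ν m₀ m₁ ε (s n) ≤ c) : essRisk ν m₀ m₁ ε (⋂ n, s n) ≤ c := by
  rw [← essRisk_compl, compl_iInter]
  refine essRisk_iUnion_le (fun i j hij => compl_subset_compl.2 (hs hij)) fun n => ?_
  rw [essRisk_compl]
  exact hc n

/-! ### Existence of essential minimizers -/

/-- `A` minimizes the essential risk among the Borel sets. -/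
def IsEssMinimizer (ν m₀ m₁ : Measure X) (ε : ℝ) (A : Set X) : Prop :=
  MeasurableSet A ∧ ∀ B : Set X, MeasurableSet B → essRisk ν m₀ m₁ ε A ≤ essRisk ν m₀ m₁ ε B

lemma IsEssMinimizer.compl (h : IsEssMinimizer ν m₀ m₁ ε A) : IsEssMinimizer ν m₁ m₀ ε Aᶜ :=
  ⟨h.1.compl, fun B hB => by
    rw [essRisk_compl, ← essRisk_compl (A := B)]
    exact h.2 _ hB.compl⟩

/-- Near-minimality is stable under unions. -/
lemma essRisk_union_le_add [OpensMeasurableSpace X] {c a b : ℝ≥0∞} (hcfin : c ≠ ∞)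
    (hc : ∀ s : Set X, MeasurableSet s → c ≤ essRisk ν m₀ m₁ ε s)
    (hA : MeasurableSet A) (hB : MeasurableSet B)
    (ha : essRisk ν m₀ m₁ ε A ≤ c + a) (hb : essRisk ν m₀ m₁ ε B ≤ c + b) :
    essRisk ν m₀ m₁ ε (A ∪ B) ≤ c + (a + b) := by
  refine (ENNReal.add_le_add_iff_right hcfin).1 ?_
  calc essRisk ν m₀ m₁ ε (A ∪ B) + c
      ≤ essRisk ν m₀ m₁ ε (A ∪ B) + essRisk ν m₀ m₁ ε (A ∩ B) := by
        gcongr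
        exact hc _ (hA.inter hB)
    _ ≤ essRisk ν m₀ m₁ ε A + essRisk ν m₀ m₁ ε B := essRisk_union_add_inter_le A B
    _ ≤ (c + a) + (c + b) := add_le_add ha hb
    _ = _ := by ring

lemma essRisk_ne_top [IsFiniteMeasure m₀] [IsFiniteMeasure m₁] : essRisk ν m₀ m₁ ε A ≠ ∞ :=
  ENNReal.add_ne_top.2 ⟨measure_ne_top _ _, measure_ne_top _ _⟩

/-- The excesses over c add up along finite unions, and the bound passes to the limit of the
increasing partial unions. -/
lemma essRisk_iUnion_le_add [OpensMeasurableSpace X] {c : ℝ≥0∞} (hcfin : c ≠ ∞)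
    (hc : ∀ s : Set X, MeasurableSet s → c ≤ essRisk ν m₀ m₁ ε s) {s : ℕ → Set X} {δ : ℕ → ℝ≥0∞}
    (hs : ∀ n, MeasurableSet (s n)) (hδ : ∀ n, essRisk ν m₀ m₁ ε (s n) ≤ c + δ n) :
    essRisk ν m₀ m₁ ε (⋃ n, s n) ≤ c + ∑' n, δ n := by
  have hmeas (n : ℕ) : MeasurableSet (partialSups s n) := by
    rw [partialSups_eq_biUnion_range]
    exact Finset.measurableSet_biUnion _ fun i _ => hs i
  have hpart (n : ℕ) : essRisk ν m₀ m₁ ε (partialSups s n)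
      ≤ c + ∑ i ∈ Finset.range (n + 1), δ i := by
    induction n with
    | zero => simpa using hδ 0
    | succ n ih =>
      rw [Finset.sum_range_succ]
      simpa using essRisk_union_le_add hcfin hc (hmeas n) (hs (n + 1)) ih (hδ (n + 1))
  have := essRisk_iUnion_le (partialSups s).monotone (c := c + ∑' n, δ n) fun n =>
    (hpart n).trans (by gcongr; exact ENNReal.sum_le_tsum _)
  rwa [show (⋃ n, partialSups s n) = ⋃ n, s n from iSup_partialSups_eq s] at this

lemma exists_isEssMinimizer [OpensMeasurableSpace X] [IsFiniteMeasure m₀] [IsFiniteMeasure m₁] :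
    ∃ A, IsEssMinimizer ν m₀ m₁ ε A := by
  set c : ℝ≥0∞ := ⨅ (B : Set X) (_ : MeasurableSet B), essRisk ν m₀ m₁ ε B with hc_def
  have hc (s : Set X) (hs : MeasurableSet s) : c ≤ essRisk ν m₀ m₁ ε s := iInf₂_le s hs
  have hcfin : c ≠ ∞ := ne_top_of_le_ne_top essRisk_ne_top (hc ∅ .empty)
  obtain ⟨δ, hδpos, hδsum⟩ := ENNReal.exists_pos_sum_of_countable' one_ne_zero ℕ
  have hex (n : ℕ) : ∃ s : Set X, MeasurableSet s ∧ essRisk ν m₀ m₁ ε s ≤ c + δ n := by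
    have hlt : c < c + δ n := ENNReal.lt_add_right hcfin (hδpos n).ne'
    rw [hc_def] at hlt
    obtain ⟨s, hs, hlt'⟩ := by simpa only [iInf_lt_iff] using hlt
    exact ⟨s, hs, hlt'.le⟩
  choose s hs hsδ using hex
  -- The minimizer is the limit superior of a minimizing sequence with summable excesses: each tail
  -- union exceeds c by at most the tail sum.
  let t : ℕ → Set X := fun k => ⋃ n, s (n + k)
  have ht (k : ℕ) : essRisk ν m₀ m₁ ε (t k) ≤ c + ∑' n, δ (n + k) :=
    essRisk_iUnion_le_add hcfin hc (fun n => hs _) fun n => hsδ _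
  have htanti : Antitone t := by
    intro i j hij
    refine iUnion_subset fun n => ?_
    have : s (n + j) = s (n + (j - i) + i) := by congr 1; omega
    rw [this]
    exact subset_iUnion (fun n => s (n + i)) _
  have htail : Tendsto (fun k => c + ∑' n, δ (n + k)) atTop (𝓝 c) := by
    simpa using (ENNReal.tendsto_sum_nat_add δ (hδsum.trans ENNReal.one_lt_top).ne).const_add c
  have hlim : essRisk ν m₀ m₁ ε (⋂ k, t k) ≤ c := by
    -- Omitting the first j tail unions does not change the intersection, and the remaining ones all
    -- have excess at most the j-th tail sum.
    refine ge_of_tendsto' htail fun j => ?_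
    rw [← htanti.iInter_nat_add j]
    refine essRisk_iInter_le (fun a b hab => htanti (by omega)) fun n => (ht _).trans ?_
    gcongr c + ?_
    rw [show (fun i => δ (i + (n + j))) = fun i => δ ((i + n) + j) by simp [add_assoc]]
    exact ENNReal.tsum_comp_le_tsum_of_injective (add_left_injective n) fun i => δ (i + j)
  exact ⟨⋂ k, t k, .iInter fun k => .iUnion fun n => hs _, fun B hB => hlim.trans (hc B hB)⟩

lemma IsEssMinimizer.union [OpensMeasurableSpace X] [IsFiniteMeasure m₀] [IsFiniteMeasure m₁]
    (hA : IsEssMinimizer ν m₀ m₁ ε A) (hB : IsEssMinimizer ν m₀ m₁ ε B) :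
    IsEssMinimizer ν m₀ m₁ ε (A ∪ B) := by
  refine ⟨hA.1.union hB.1, fun C hC => le_trans ?_ (hA.2 C hC)⟩
  simpa using essRisk_union_le_add (a := 0) (b := 0) essRisk_ne_top hA.2 hA.1 hB.1
    (by simp) (by simpa using hB.2 _ hA.1)

lemma IsEssMinimizer.iUnion [OpensMeasurableSpace X] [IsFiniteMeasure m₀] [IsFiniteMeasure m₁]
    {s : ℕ → Set X} (hs : ∀ n, IsEssMinimizer ν m₀ m₁ ε (s n)) :
    IsEssMinimizer ν m₀ m₁ ε (⋃ n, s n) := by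
  refine ⟨.iUnion fun n => (hs n).1, fun C hC => le_trans ?_ ((hs 0).2 C hC)⟩
  simpa using essRisk_iUnion_le_add (δ := 0) essRisk_ne_top (hs 0).2 (fun n => (hs n).1)
    (fun n => by simpa using (hs n).2 _ (hs 0).1)

/-- There is an essential minimizer that contains all others up to `ν`-null sets. -/
lemma exists_isEssMinimizer_greatest [OpensMeasurableSpace X] [IsFiniteMeasure ν]
    [IsFiniteMeasure m₀] [IsFiniteMeasure m₁] :
    ∃ A, IsEssMinimizer ν m₀ m₁ ε A ∧ ∀ B, IsEssMinimizer ν m₀ m₁ ε B → ν (B \ A) = 0 := by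
  -- The union of a sequence of minimizers whose ν-measures approach the supremum is a minimizer
  -- attaining it; uniting it with another minimizer cannot add mass.
  let S : Set ℝ≥0∞ := ν '' {A | IsEssMinimizer ν m₀ m₁ ε A}
  have hS : S.Nonempty := Set.Nonempty.image ν exists_isEssMinimizer
  obtain ⟨u, -, hu, huS⟩ := exists_seq_tendsto_sSup hS (OrderTop.bddAbove S)
  choose s hs hsu using huS
  have hmin := IsEssMinimizer.iUnion hs
  have hsup : sSup S ≤ ν (⋃ n, s n) :=
    le_of_tendsto' hu fun n => (hsu n).symm.le.trans (measure_mono (subset_iUnion s n))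
  refine ⟨⋃ n, s n, hmin, fun B hB => ?_⟩
  have hle : ν ((⋃ n, s n) ∪ B) ≤ ν (⋃ n, s n) :=
    (le_sSup ⟨_, hmin.union hB, rfl⟩ : _ ≤ sSup S).trans hsup
  rw [← union_sdiff_self, measure_union disjoint_sdiff_right (hB.1.diff hmin.1)] at hle
  exact nonpos_iff_eq_zero.1
    ((ENNReal.add_le_add_iff_left (measure_ne_top ν (⋃ n, s n))).1 (by simpa using hle))

/-! ### Density representatives -/

lemma measure_ball_pos_of_mem_support {x : X} (hx : x ∈ ν.support) {r : ℝ} (hr : 0 < r) :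
    0 < ν (Metric.ball x r) :=
  (Measure.mem_support_iff_forall x).1 hx _ (Metric.ball_mem_nhds x hr)

lemma upperRep_mono_ae (h : ν (A \ B) = 0) : upperRep ν A ⊆ upperRep ν B := by
  intro x hx hxν
  refine (hx hxν).trans_le (limsup_le_limsup (Eventually.of_forall fun r => ?_))
  refine ENNReal.div_le_div_right ?_ _
  refine (measure_mono (t := Metric.ball x r ∩ B ∪ A \ B) ?_).trans
    ((measure_union_le _ _).trans (by simp [h]))
  rintro y ⟨hy, hyA⟩
  by_cases hyB : y ∈ B
  · exact Or.inl ⟨hy, hyB⟩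
  · exact Or.inr ⟨hyA, hyB⟩

/-- On the support the density quotients of A and Aᶜ sum to one. This duality carries results on A⁺
over to A⁻. -/
lemma lowerRep_eq_compl_upperRep_compl [OpensMeasurableSpace X] [IsFiniteMeasure ν]
    (hA : MeasurableSet A) : lowerRep ν A = (upperRep ν Aᶜ)ᶜ := by
  ext x
  simp only [lowerRep, upperRep, mem_ofPred_eq, mem_compl_iff, Classical.not_imp, not_lt,
    nonpos_iff_eq_zero]
  refine and_congr_right fun hx => ?_
  have hev : (fun r : ℝ => ν (Metric.ball x r ∩ A) / ν (Metric.ball x r)) =ᶠ[𝓝[>] 0]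
      fun r : ℝ => 1 - ν (Metric.ball x r ∩ Aᶜ) / ν (Metric.ball x r) := by
    filter_upwards [self_mem_nhdsWithin] with r hr
    have hpos := (measure_ball_pos_of_mem_support hx hr).ne'
    have hsum : ν (Metric.ball x r ∩ A) + ν (Metric.ball x r ∩ Aᶜ) = ν (Metric.ball x r) := by
      rw [← sdiff_eq]
      exact measure_inter_add_sdiff _ hA
    refine ENNReal.eq_sub_of_add_eq
      (ENNReal.div_ne_top (measure_ne_top _ _) hpos) ?_
    rw [← ENNReal.add_div, hsum, ENNReal.div_self hpos (measure_ne_top _ _)]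
  rw [liminf_congr hev, ENNReal.liminf_const_sub _ _ ENNReal.one_ne_top]
  set L := limsup (fun r : ℝ => ν (Metric.ball x r ∩ Aᶜ) / ν (Metric.ball x r)) (𝓝[>] 0)
  constructor
  · intro h
    by_contra hL
    exact (ENNReal.sub_lt_self ENNReal.one_ne_top one_ne_zero hL).ne h
  · intro h
    simp [h]

/-- At almost every point of `A` the upper density of `A` is positive, for a measure that is
locally doubling at almost every point. -/
lemma measure_diff_upperRep [OpensMeasurableSpace X] [SecondCountableTopology X]
    [IsFiniteMeasure ν]
    (hd : ∀ᵐ x ∂ν,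
      limsup (fun r : ℝ => ν (Metric.ball x (2 * r)) / ν (Metric.ball x r)) (𝓝[>] 0) < ∞)
    (A : Set X) : ν (A \ upperRep ν A) = 0 := by
  let S : ℕ → Set X := fun n => {x | x ∈ A ∧ x ∈ ν.support ∧
    limsup (fun r : ℝ => ν (Metric.ball x r ∩ A) / ν (Metric.ball x r)) (𝓝[>] 0) = 0 ∧
    limsup (fun r : ℝ => ν (Metric.ball x (2 * r)) / ν (Metric.ball x r)) (𝓝[>] 0) < n}
  suffices hS : ∀ n, ν (S n) = 0 by
    refine measure_mono_null ?_ (measure_union_null (measure_iUnion_null hS) (ae_iff.1 hd))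
    rintro x ⟨hxA, hx⟩
    simp only [upperRep, mem_ofPred_eq, Classical.not_imp, not_lt, nonpos_iff_eq_zero] at hx
    by_cases hlim : limsup (fun r : ℝ => ν (Metric.ball x (2 * r)) / ν (Metric.ball x r))
        (𝓝[>] 0) < ∞
    · obtain ⟨n, hn⟩ := ENNReal.exists_nat_gt hlim.ne
      exact Or.inl (mem_iUnion.2 ⟨n, hxA, hx.1, hx.2, hn⟩)
    · exact Or.inr hlim
  intro n
  have hbound (δ : ℝ≥0∞) (hδ : 0 < δ) : ν (S n) ≤ δ * (n * ν univ) := by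
    -- Good balls for a Vitali covering: A fills at most the fraction δn of each, and tripling the
    -- radius costs at most the factor n². Disjoint good balls cover almost all of `S n`, which lies
    -- in A, so its measure is at most δ n ν(X).
    let t : Set (X × ℝ) := {a | 0 < a.2 ∧
      ν (Metric.closedBall a.1 (3 * a.2)) ≤ n * n * ν (Metric.closedBall a.1 a.2) ∧
      ν (Metric.closedBall a.1 a.2 ∩ A) ≤ δ * (n * ν (Metric.closedBall a.1 a.2))}
    have hfine (x : X) (hx : x ∈ S n) (η : ℝ) (hη : η > 0) :
        ∃ a ∈ t, a.2 ≤ η ∧ a.1 = x := by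
      obtain ⟨-, hxν, hdens, hdoub⟩ := hx
      have e1 : ∀ᶠ r : ℝ in 𝓝[>] 0, ν (Metric.ball x (2 * r)) ≤ n * ν (Metric.ball x r) := by
        filter_upwards [eventually_lt_of_limsup_lt hdoub, self_mem_nhdsWithin] with r hr hr0
        exact (ENNReal.div_le_iff (measure_ball_pos_of_mem_support hxν hr0).ne'
          (measure_ne_top _ _)).1 hr.le
      have e2 : ∀ᶠ r : ℝ in 𝓝[>] 0, ν (Metric.ball x r ∩ A) ≤ δ * ν (Metric.ball x r) := by
        filter_upwards [eventually_lt_of_limsup_lt (hdens.trans_lt hδ), self_mem_nhdsWithin]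
          with r hr hr0
        exact (ENNReal.div_le_iff (measure_ball_pos_of_mem_support hxν hr0).ne'
          (measure_ne_top _ _)).1 hr.le
      have htwo : Tendsto (fun r : ℝ => 2 * r) (𝓝[>] 0) (𝓝[>] 0) := by
        refine tendsto_nhdsWithin_iff.2 ⟨?_, ?_⟩
        · have : Tendsto (fun r : ℝ => 2 * r) (𝓝 0) (𝓝 (2 * 0)) := tendsto_id.const_mul 2
          rw [mul_zero] at this
          exact this.mono_left nhdsWithin_le_nhds
        · filter_upwards [self_mem_nhdsWithin] with r hr
          exact mul_pos two_pos (mem_Ioi.1 hr)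
      have e3 : ∀ᶠ r : ℝ in 𝓝[>] 0, r ∈ Ioo 0 η := Ioo_mem_nhdsGT hη
      -- Doubling is used at r and 2r, since the closed 3r-ball lies in the open 4r-ball; the
      -- density bound is used at 2r, since the closed r-ball lies in the open 2r-ball.
      obtain ⟨r, h1, h1', h2, hr0, hrη⟩ :=
        (e1.and ((htwo.eventually e1).and ((htwo.eventually e2).and e3))).exists
      have hbc : ν (Metric.ball x r) ≤ ν (Metric.closedBall x r) :=
        measure_mono Metric.ball_subset_closedBall
      refine ⟨(x, r), ⟨hr0, ?_, ?_⟩, hrη.le, rfl⟩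
      · calc ν (Metric.closedBall x (3 * r)) ≤ ν (Metric.ball x (2 * (2 * r))) :=
              measure_mono (Metric.closedBall_subset_ball (by linarith))
          _ ≤ n * (n * ν (Metric.ball x r)) := h1'.trans (by gcongr)
          _ ≤ n * n * ν (Metric.closedBall x r) := by rw [mul_assoc]; gcongr
      · calc ν (Metric.closedBall x r ∩ A) ≤ ν (Metric.ball x (2 * r) ∩ A) :=
              measure_mono (inter_subset_inter_left _
                (Metric.closedBall_subset_ball (by linarith)))
          _ ≤ δ * (n * ν (Metric.ball x r)) := h2.trans (by gcongr)
          _ ≤ δ * (n * ν (Metric.closedBall x r)) := by gcongr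
    obtain ⟨u, hut, hu, hdisj, hcov⟩ := Vitali.exists_disjoint_covering_ae ν (S n) t
      ((n : NNReal) * n) Prod.snd Prod.fst (fun a => Metric.closedBall a.1 a.2)
      (fun a _ => Subset.rfl) (fun a ha => by simpa using ha.2.1)
      (fun a ha => ⟨a.1, Metric.ball_subset_interior_closedBall (Metric.mem_ball_self ha.1)⟩)
      (fun a _ => Metric.isClosed_closedBall) hfine
    have hsub : S n ⊆ (S n \ ⋃ a ∈ u, Metric.closedBall a.1 a.2) ∪
        ⋃ a ∈ u, Metric.closedBall a.1 a.2 ∩ A := by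
      intro x hx
      by_cases h : x ∈ ⋃ a ∈ u, Metric.closedBall a.1 a.2
      · refine Or.inr ?_
        simp only [mem_iUnion] at h ⊢
        obtain ⟨a, ha, hxa⟩ := h
        exact ⟨a, ha, hxa, hx.1⟩
      · exact Or.inl ⟨hx, h⟩
    have : Countable u := hu.to_subtype
    calc ν (S n) ≤ ν (S n \ ⋃ a ∈ u, Metric.closedBall a.1 a.2) +
          ν (⋃ a ∈ u, Metric.closedBall a.1 a.2 ∩ A) :=
          (measure_mono hsub).trans (measure_union_le _ _)
      _ ≤ ∑' a : u, ν (Metric.closedBall a.1.1 a.1.2 ∩ A) := by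
          rw [hcov, zero_add]
          exact measure_biUnion_le ν hu _
      _ ≤ ∑' a : u, δ * (n * ν (Metric.closedBall a.1.1 a.1.2)) :=
          ENNReal.tsum_le_tsum fun a => (hut a.2).2.2
      _ = δ * (n * ν (⋃ a ∈ u, Metric.closedBall a.1 a.2)) := by
          rw [ENNReal.tsum_mul_left, ENNReal.tsum_mul_left, measure_biUnion hu hdisj
            fun a _ => Metric.isClosed_closedBall.measurableSet]
      _ ≤ δ * (n * ν univ) := by gcongr; exact subset_univ _
  have hM : (n * ν univ : ℝ≥0∞) ≠ ∞ :=
    ENNReal.mul_ne_top (ENNReal.natCast_ne_top n) (measure_ne_top _ _)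
  have hlim : Tendsto (fun δ : ℝ≥0∞ => δ * (n * ν univ)) (𝓝[>] 0) (𝓝 0) := by
    have := ENNReal.Tendsto.mul_const (tendsto_id (α := ℝ≥0∞) (x := 𝓝 0)) (b := n * ν univ)
      (Or.inr hM)
    rw [zero_mul] at this
    exact this.mono_left nhdsWithin_le_nhds
  exact nonpos_iff_eq_zero.1 (ge_of_tendsto hlim
    (by filter_upwards [self_mem_nhdsWithin] with δ hδ using hbound δ hδ))

/-! ### The adversarial risk of a set in terms of the class measures -/

/-- The adversarial risk, for the class measures `m₀` and `m₁`. -/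
def classRisk (m₀ m₁ : Measure X) (ε : ℝ) (A : Set X) : ℝ≥0∞ :=
  m₀ (Metric.thickening ε A) + m₁ (Metric.thickening ε Aᶜ)

lemma classRisk_compl : classRisk m₁ m₀ ε Aᶜ = classRisk m₀ m₁ ε A := by
  simp [classRisk, add_comm]

lemma essRisk_le_classRisk : essRisk ν m₀ m₁ ε A ≤ classRisk m₀ m₁ ε A :=
  add_le_add (measure_mono essThickening_subset_thickening)
    (measure_mono essThickening_subset_thickening)

/-- Every Borel set has a representative whose adversarial risk is the essential risk. -/
lemma exists_nuEquiv_classRisk_le [OpensMeasurableSpace X] [SecondCountableTopology X]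
    (h₀ : ∀ᵐ x ∂m₀, Metric.ball x ε ⊆ ν.support) (hA : MeasurableSet A) :
    ∃ B, MeasurableSet B ∧ NuEquiv ν A B ∧ classRisk m₀ m₁ ε B ≤ essRisk ν m₀ m₁ ε A := by
  set S := (ν.restrict A).support with hS
  set T := (ν.restrict Aᶜ).support with hT
  have hSA : ν (A \ S) = 0 := by
    have : (ν.restrict A) Sᶜ = 0 := Measure.measure_compl_support
    rwa [Measure.restrict_apply Measure.isClosed_support.measurableSet.compl, inter_comm,
      ← sdiff_eq] at this
  have hTA : ν (Tᶜ \ A) = 0 := by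
    have : (ν.restrict Aᶜ) Tᶜ = 0 := Measure.measure_compl_support
    rwa [Measure.restrict_apply Measure.isClosed_support.measurableSet.compl, ← sdiff_eq] at this
  have hST : ν.support ⊆ S ∪ T := by
    rw [hS, hT, ← Measure.support_add, Measure.restrict_add_restrict_compl hA]
  have key (s : Set X) (x y : X) (hxy : dist x y < ε) (hy : y ∈ (ν.restrict s).support) :
      x ∈ essThickening ν ε s := by
    have := (Measure.mem_support_iff_forall y).1 hy (Metric.ball x ε)
      (Metric.isOpen_ball.mem_nhds (by rwa [Metric.mem_ball, dist_comm]))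
    rw [Measure.restrict_apply Metric.isOpen_ball.measurableSet] at this
    exact this.ne'
  -- Dropping from A the points outside `S` and adding those outside `T` changes a null set.
  -- Afterwards members in the support of ν lie in `S` and all non-members lie in `T`, so every ball
  -- reaching them meets A, respectively Aᶜ, in positive measure.
  refine ⟨A ∩ S ∪ Tᶜ, (hA.inter Measure.isClosed_support.measurableSet).union
    Measure.isClosed_support.measurableSet.compl, ?_, add_le_add (measure_mono_ae ?_)
    (measure_mono_ae ?_)⟩
  · refine measure_mono_null ?_ (measure_union_null hSA hTA)
    rintro x (⟨hxA, hx⟩ | ⟨hx, hxA⟩)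
    · exact Or.inl ⟨hxA, fun hxS => hx (Or.inl ⟨hxA, hxS⟩)⟩
    · exact Or.inr ⟨hx.resolve_left fun h => hxA h.1, hxA⟩
  · filter_upwards [h₀] with x hx hxt
    obtain ⟨y, hy, hxy⟩ := Metric.mem_thickening_iff.1 hxt
    have hyν : y ∈ ν.support := hx (by rwa [Metric.mem_ball, dist_comm])
    refine key A x y hxy ?_
    rcases hy with hy | hy
    · exact hy.2
    · exact (hST hyν).resolve_right hy
  · refine Eventually.of_forall fun x hxt => ?_
    obtain ⟨y, hy, hxy⟩ := Metric.mem_thickening_iff.1 hxt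
    exact key Aᶜ x y hxy (not_not.1 fun h => hy (Or.inr h))

/-- The closing has the dilation of A⁺, and a point of positive upper density gives positive mass of
A to every ball containing it. The complement of the closing is open, so a ball meeting it inside
the support does so in positive measure; as A lies a.e. in A⁺, that mass belongs to Aᶜ. -/
lemma classRisk_closing_upperRep_le
    (h₀ : ∀ᵐ x ∂m₀, Metric.ball x ε ⊆ ν.support) (h₁ : ∀ᵐ x ∂m₁, Metric.ball x ε ⊆ ν.support)
    (hA : ν (A \ upperRep ν A) = 0) :
    classRisk m₀ m₁ ε (closing ε (upperRep ν A)) ≤ essRisk ν m₀ m₁ ε A := by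
  refine add_le_add (measure_mono_ae ?_) (measure_mono_ae ?_)
  · filter_upwards [h₀] with x hx hxt
    rw [thickening_closing] at hxt
    obtain ⟨y, hy, hxy⟩ := Metric.mem_thickening_iff.1 hxt
    have hyx : y ∈ Metric.ball x ε := by rwa [Metric.mem_ball, dist_comm]
    intro h0
    refine (hy (hx hyx)).ne' ?_
    have hev : ∀ᶠ r : ℝ in 𝓝[>] 0,
        ν (Metric.ball y r ∩ A) / ν (Metric.ball y r) = (fun _ => 0) r := by
      have : ∀ᶠ r : ℝ in 𝓝[>] 0, r ∈ Ioo 0 (ε - dist x y) := Ioo_mem_nhdsGT (sub_pos.2 hxy)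
      filter_upwards [this] with r hr
      have : ν (Metric.ball y r ∩ A) = 0 := measure_mono_null (inter_subset_inter_left _
        (Metric.ball_subset_ball' (by rw [dist_comm]; linarith [hr.2]))) h0
      simp [this]
    rw [limsup_congr hev, limsup_const]
  · filter_upwards [h₁] with x hx hxt
    obtain ⟨y, hy, hxy⟩ := Metric.mem_thickening_iff.1 hxt
    have hyx : y ∈ Metric.ball x ε := by rwa [Metric.mem_ball, dist_comm]
    intro h0
    refine ((Measure.mem_support_iff_forall y).1 (hx hyx) _ ((Metric.isOpen_ball.inter
      (isClosed_closing ε (upperRep ν A)).isOpen_compl).mem_nhds ⟨hyx, hy⟩)).ne' ?_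
    refine measure_mono_null ?_ (measure_union_null h0 hA)
    rintro z ⟨hz, hzC⟩
    by_cases hzA : z ∈ A
    · exact Or.inr ⟨hzA, fun h => hzC (subset_closing _ _ h)⟩
    · exact Or.inl ⟨hz, hzA⟩

/-- `A` is an essential minimizer that contains all others up to null sets. -/
def IsGreatestEssMinimizer (ν m₀ m₁ : Measure X) (ε : ℝ) (A : Set X) : Prop :=
  IsEssMinimizer ν m₀ m₁ ε A ∧ ∀ B, IsEssMinimizer ν m₀ m₁ ε B → ν (B \ A) = 0

/-- The closing is itself an essential minimizer, so greatestness of A gives the nontrivial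
inclusion. -/
lemma IsGreatestEssMinimizer.nuEquiv_closing [OpensMeasurableSpace X]
    (h : IsGreatestEssMinimizer ν m₀ m₁ ε A)
    (h₀ : ∀ᵐ x ∂m₀, Metric.ball x ε ⊆ ν.support) (h₁ : ∀ᵐ x ∂m₁, Metric.ball x ε ⊆ ν.support)
    (hA : ν (A \ upperRep ν A) = 0) : NuEquiv ν A (closing ε (upperRep ν A)) := by
  refine measure_union_null (measure_mono_null ?_ hA) (h.2 _ ⟨?_, fun B hB => ?_⟩)
  · exact sdiff_subset_sdiff_right (subset_closing _ _)
  · exact (isClosed_closing _ _).measurableSet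
  · exact (essRisk_le_classRisk.trans (classRisk_closing_upperRep_le h₀ h₁ hA)).trans (h.1.2 B hB)

/-! ### Both objectives in terms of the class measures -/

lemma advRisk_eq_classRisk [OpensMeasurableSpace X] (ε : ℝ) (A : Set X) :
    advRisk ε μ A = classRisk (classMeasure μ 0) (classMeasure μ 1) ε A := by
  have hm (s : Set X) : MeasurableSet (Metric.thickening ε s) :=
    Metric.isOpen_thickening.measurableSet
  rw [advRisk, lintegral_eq_add_classMeasure
    (g₀ := (Metric.thickening ε A).indicator 1) (g₁ := (Metric.thickening ε Aᶜ).indicator 1),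
    lintegral_indicator_one (hm _), lintegral_indicator_one (hm _), classRisk]
  · intro x
    simp only [loss_zero, iSup_ball_indicator]
  · intro x
    simp only [loss_one, iSup_ball_indicator]
  · exact measurable_one.indicator (hm _)
  · exact measurable_one.indicator (hm _)

lemma ofReal_mul_prePerimeter [OpensMeasurableSpace X] [IsFiniteMeasure μ] (hε : 0 < ε)
    (hA : MeasurableSet A) :
    ENNReal.ofReal ε * prePerimeter ε μ A =
      classMeasure μ 0 (Metric.thickening ε A \ A) +
        classMeasure μ 1 (Metric.thickening ε Aᶜ \ Aᶜ) := by
  have hm (s : Set X) : MeasurableSet (Metric.thickening ε s) :=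
    Metric.isOpen_thickening.measurableSet
  have h0 (x : X) : (⨆ x' ∈ Metric.ball x ε, ind A x') - ind A x =
      (Metric.thickening ε A \ A).indicator 1 x := by
    simp only [ind, iSup_ball_indicator]
    have hsub : x ∈ A → x ∈ Metric.thickening ε A :=
      fun h => Metric.self_subset_thickening hε A h
    by_cases h : x ∈ A <;> by_cases h' : x ∈ Metric.thickening ε A <;> simp_all
  have h1 (x : X) : ind A x - (⨅ x' ∈ Metric.ball x ε, ind A x') =
      (Metric.thickening ε Aᶜ \ Aᶜ).indicator 1 x := by
    by_cases h : x ∈ A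
    · by_cases h' : x ∈ Metric.thickening ε Aᶜ
      · obtain ⟨y, hy, hxy⟩ := Metric.mem_thickening_iff.1 h'
        have : ⨅ x' ∈ Metric.ball x ε, ind A x' = 0 :=
          nonpos_iff_eq_zero.1 ((iInf₂_le y (by rwa [Metric.mem_ball, dist_comm])).trans
            (by simp [ind, (mem_compl_iff _ _).1 hy]))
        rw [this, tsub_zero, indicator_of_mem (mem_sdiff_of_mem h' (not_not.2 h)), ind,
          indicator_of_mem h, Pi.one_apply]
      · have : 1 ≤ ⨅ x' ∈ Metric.ball x ε, ind A x' := by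
          refine le_iInf₂ fun z hz => ?_
          have : z ∈ A := by
            by_contra hzA
            exact h' (Metric.mem_thickening_iff.2 ⟨z, hzA, by rwa [dist_comm]⟩)
          simp [ind, this]
        rw [indicator_of_notMem fun hc => h' hc.1, ind, indicator_of_mem h]
        exact tsub_eq_zero_of_le this
    · simp [ind, h]
  have hc (i : Fin 2) (I : ℝ≥0∞) : ENNReal.ofReal ε * (classWeight μ i / ENNReal.ofReal ε * I) =
      classWeight μ i * I := by
    rw [← mul_assoc, ENNReal.mul_div_cancel (by simpa using hε) ENNReal.ofReal_ne_top]
  rw [prePerimeter, mul_add, hc, hc]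
  simp only [h0, h1]
  rw [← smul_eq_mul, ← smul_eq_mul, ← lintegral_smul_measure, ← lintegral_smul_measure,
    classWeight_smul_classDist, classWeight_smul_classDist,
    lintegral_indicator_one ((hm _).diff hA), lintegral_indicator_one ((hm _).diff hA.compl)]

/-- The adversarial risk is the standard risk plus `ε` times the pre-perimeter. -/
lemma lintegral_loss_add_prePerimeter [OpensMeasurableSpace X] [IsFiniteMeasure μ] (hε : 0 < ε)
    (hA : MeasurableSet A) :
    ∫⁻ z, loss A z.1 z.2 ∂μ + ENNReal.ofReal ε * prePerimeter ε μ A =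
      classRisk (classMeasure μ 0) (classMeasure μ 1) ε A := by
  have key (m : Measure X) {s : Set X} (hs : MeasurableSet s) :
      m s + m (Metric.thickening ε s \ s) = m (Metric.thickening ε s) := by
    rw [← measure_union disjoint_sdiff_right
      (Metric.isOpen_thickening.measurableSet.diff hs), union_sdiff_cancel
      (Metric.self_subset_thickening hε s)]
  rw [lintegral_loss hA, ofReal_mul_prePerimeter hε hA, add_add_add_comm, key _ hA,
    key _ hA.compl, classRisk]

lemma perRisk_eq_essRisk [OpensMeasurableSpace X] [SecondCountableTopology X] [IsFiniteMeasure μ]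
    (hε : 0 < ε) (hac : dataMarginal μ ≪ ν)
    (hsupp : ∀ i, ∀ᵐ x ∂(classMeasure μ i), Metric.ball x ε ⊆ ν.support) (hA : MeasurableSet A) :
    perRisk ν ε μ A = essRisk ν (classMeasure μ 0) (classMeasure μ 1) ε A := by
  have hloss {B : Set X} (hB : MeasurableSet B) (h : NuEquiv ν A B) :
      ∫⁻ z, loss A z.1 z.2 ∂μ = ∫⁻ z, loss B z.1 z.2 ∂μ := by
    have hm (i : Fin 2) : classMeasure μ i ≪ ν :=
      (classMeasure_le_dataMarginal i).absolutelyContinuous.trans hac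
    rw [lintegral_loss hA, lintegral_loss hB, measure_congr_of_nuEquiv (hm 0) h,
      measure_congr_of_nuEquiv (hm 1) h.compl]
  refine le_antisymm ?_ ?_
  · obtain ⟨B, hB, hAB, hle⟩ := exists_nuEquiv_classRisk_le (hsupp 0) hA
    refine le_trans ?_ hle
    rw [← lintegral_loss_add_prePerimeter hε hB, perRisk, hloss hB hAB]
    gcongr
    exact iInf_le_of_le B (iInf₂_le hB hAB)
  · have hε0 : ENNReal.ofReal ε ≠ 0 := by simpa using hε
    simp only [perRisk, perimeter, ENNReal.mul_iInf_of_ne hε0 ENNReal.ofReal_ne_top,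
      ENNReal.add_iInf]
    refine le_iInf fun B => ?_
    by_cases hB : MeasurableSet B
    · by_cases hAB : NuEquiv ν A B
      · simp only [hB, hAB, iInf_pos]
        rw [hloss hB hAB, lintegral_loss_add_prePerimeter hε hB, essRisk_congr hAB]
        exact essRisk_le_classRisk
      · simp [hAB]
    · simp [hB]

/-! ### Solutions of the two problems -/

lemma IsReferenceMeasure.ae_ball_subset_support [OpensMeasurableSpace X]
    [SecondCountableTopology X] (hν : IsReferenceMeasure ν ε μ) (i : Fin 2) :
    ∀ᵐ x ∂(classMeasure μ i), Metric.ball x ε ⊆ ν.support := by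
  refine (classMeasure_le_dataMarginal i).absolutelyContinuous.ae_le ?_
  filter_upwards [Measure.support_mem_ae (μ := dataMarginal μ)] with x hx y hy
  exact hν.thickening_subset (Metric.mem_thickening_iff.2 ⟨x, hx, hy⟩)

section Solutions

variable [OpensMeasurableSpace X] [SecondCountableTopology X] [IsFiniteMeasure μ]

lemma IsReferenceMeasure.isPerSolution_iff (hν : IsReferenceMeasure ν ε μ) (hε : 0 < ε) :
    IsPerSolution ν ε μ A ↔ IsEssMinimizer ν (classMeasure μ 0) (classMeasure μ 1) ε A := by
  have h {C : Set X} (hC : MeasurableSet C) :=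
    perRisk_eq_essRisk hε hν.absolutelyContinuous hν.ae_ball_subset_support hC
  refine and_congr_right fun hA => forall₂_congr fun B hB => ?_
  rw [h hA, h hB]

lemma IsReferenceMeasure.isMaxPerSolution_iff (hν : IsReferenceMeasure ν ε μ) (hε : 0 < ε) :
    IsMaxPerSolution ν ε μ A ↔
      IsGreatestEssMinimizer ν (classMeasure μ 0) (classMeasure μ 1) ε A := by
  simp only [IsMaxPerSolution, hν.isPerSolution_iff hε, nuLE_iff]
  -- Maximal implies greatest because the union with any other minimizer is again a minimizer.
  refine and_congr_right fun hA => ⟨fun h B hB => ?_, fun h B hB hAB => ?_⟩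
  · refine measure_mono_null ?_ (h (A ∪ B) (hA.union hB)
      (by rw [sdiff_eq_empty.2 subset_union_left, measure_empty]))
    exact fun x hx => Or.inr ⟨Or.inr hx.1, hx.2⟩
  · exact measure_union_null hAB (h B hB)

lemma IsReferenceMeasure.isMinPerSolution_iff (hν : IsReferenceMeasure ν ε μ) (hε : 0 < ε) :
    IsMinPerSolution ν ε μ A ↔
      IsGreatestEssMinimizer ν (classMeasure μ 1) (classMeasure μ 0) ε Aᶜ := by
  have hcompl {s : Set X} : IsEssMinimizer ν (classMeasure μ 1) (classMeasure μ 0) ε sᶜ ↔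
      IsEssMinimizer ν (classMeasure μ 0) (classMeasure μ 1) ε s :=
    ⟨fun h => by simpa using h.compl, fun h => h.compl⟩
  simp only [IsMinPerSolution, IsGreatestEssMinimizer, hν.isPerSolution_iff hε, nuLE_iff, hcompl]
  refine and_congr_right fun hA => ⟨fun h B hB => ?_, fun h B hB hBA => ?_⟩
  · have hmin := (hA.compl.union hB).compl
    rw [compl_union, compl_compl] at hmin
    refine measure_mono_null ?_ (h _ hmin
      (by rw [sdiff_eq_empty.2 inter_subset_left, measure_empty]))
    exact fun x hx => Or.inl ⟨not_not.1 hx.2, fun hc => hc.2 hx.1⟩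
  · refine measure_union_null (measure_mono_null ?_ (h _ hB.compl)) hBA
    exact fun x hx => ⟨hx.2, not_not.2 hx.1⟩

end Solutions

lemma IsEssMinimizer.isAdvSolution [OpensMeasurableSpace X]
    (h : IsEssMinimizer ν (classMeasure μ 0) (classMeasure μ 1) ε A) (hB : MeasurableSet B)
    (hle : classRisk (classMeasure μ 0) (classMeasure μ 1) ε B ≤
      essRisk ν (classMeasure μ 0) (classMeasure μ 1) ε A) : IsAdvSolution ε μ B := by
  refine ⟨hB, fun C hC => ?_⟩
  rw [advRisk_eq_classRisk, advRisk_eq_classRisk]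
  exact hle.trans ((h.2 C hC).trans essRisk_le_classRisk)

lemma upperRep_congr (h : NuEquiv ν A B) : upperRep ν A = upperRep ν B :=
  (upperRep_mono_ae (measure_mono_null subset_union_left h)).antisymm
    (upperRep_mono_ae (measure_mono_null subset_union_right h))

lemma lowerRep_subset_upperRep : lowerRep ν A ⊆ upperRep ν A := by
  rintro x ⟨-, hx⟩ -
  exact (zero_lt_one.trans_eq hx.symm).trans_le liminf_le_limsup

lemma IsGreatestEssMinimizer.nuEquiv (hA : IsGreatestEssMinimizer ν m₀ m₁ ε A)
    (hB : IsGreatestEssMinimizer ν m₀ m₁ ε B) : NuEquiv ν A B :=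
  measure_union_null (hB.2 A hA.1) (hA.2 B hB.1)

end

end AdvTraining

/-! ### The main theorem -/

open MeasureTheory AdvTraining in
theorem mainTheorem9 {X : Type*} [MetricSpace X] [TopologicalSpace.SeparableSpace X]
    [MeasurableSpace X] [BorelSpace X]
    (μ : MeasureTheory.Measure (X × Fin 2)) [MeasureTheory.IsProbabilityMeasure μ]
    (ε : ℝ) (hε : 0 < ε)
    (ν : MeasureTheory.Measure X) [MeasureTheory.IsFiniteMeasure ν]
    (hν : AdvTraining.IsReferenceMeasure ν ε μ) :
    (∃ Amax : Set X, AdvTraining.IsMaxPerSolution ν ε μ Amax) ∧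
    (∃ Amin : Set X, AdvTraining.IsMinPerSolution ν ε μ Amin) ∧
    ∃ Aplus Aminus : Set X,
      AdvTraining.IsAdvSolution ε μ Aplus ∧ AdvTraining.IsAdvSolution ε μ Aminus ∧
      Aminus ⊆ Aplus ∧
      IsClosed Aplus ∧ IsOpen Aminus ∧
      (AdvTraining.AttainsDistance X ε →
        AdvTraining.OuterRegularAt ε Aplus ∧ AdvTraining.InnerRegularAt ε Aminus) ∧
      (∀ Amax : Set X, AdvTraining.IsMaxPerSolution ν ε μ Amax →
        AdvTraining.NuEquiv ν Amax Aplus ∧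
        Aplus = AdvTraining.closing ε (AdvTraining.upperRep ν Amax)) ∧
      (∀ Amin : Set X, AdvTraining.IsMinPerSolution ν ε μ Amin →
        AdvTraining.NuEquiv ν Amin Aminus ∧
        Aminus = AdvTraining.opening ε (AdvTraining.lowerRep ν Amin)) := by
  have : SecondCountableTopology X := UniformSpace.secondCountable_of_separable X
  have h₀ := hν.ae_ball_subset_support 0
  have h₁ := hν.ae_ball_subset_support 1
  have hdiff := measure_diff_upperRep hν.locallyDoubling
  obtain ⟨G, hG⟩ : ∃ G, IsGreatestEssMinimizer ν (classMeasure μ 0) (classMeasure μ 1) ε G :=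
    exists_isEssMinimizer_greatest
  -- With the class measures swapped, the complement of a greatest minimizer is a minimal solution
  -- of the original problem.
  obtain ⟨K, hK⟩ : ∃ K, IsGreatestEssMinimizer ν (classMeasure μ 1) (classMeasure μ 0) ε K :=
    exists_isEssMinimizer_greatest
  have hKc : lowerRep ν Kᶜ = (upperRep ν K)ᶜ := by
    rw [lowerRep_eq_compl_upperRep_compl hK.1.1.compl, compl_compl]
  have hmeas (s : Set X) : MeasurableSet (closing ε s) := (isClosed_closing ε s).measurableSet
  refine ⟨⟨G, (hν.isMaxPerSolution_iff hε).2 hG⟩,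
    ⟨Kᶜ, (hν.isMinPerSolution_iff hε).2 (by rwa [compl_compl])⟩,
    closing ε (upperRep ν G), (closing ε (upperRep ν K))ᶜ, ?_, ?_, ?_, isClosed_closing _ _,
    (isClosed_closing _ _).isOpen_compl, fun h => ⟨h.outerRegularAt_closing _,
      (h.outerRegularAt_closing _).innerRegularAt_compl⟩, fun A hA => ?_, fun A hA => ?_⟩
  · exact hG.1.isAdvSolution (hmeas _) (classRisk_closing_upperRep_le h₀ h₁ (hdiff G))
  · refine hK.1.compl.isAdvSolution (hmeas _).compl ?_
    rw [classRisk_compl, essRisk_compl]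
    exact classRisk_closing_upperRep_le h₁ h₀ (hdiff K)
  -- The opening shrinks (Kᶜ)⁻ ⊆ (Kᶜ)⁺, the minimizer Kᶜ lies a.e. in G, and the closing enlarges
  -- G⁺.
  · rw [← opening_compl, ← hKc]
    refine (opening_subset _ _).trans (lowerRep_subset_upperRep.trans
      (subset_trans (upperRep_mono_ae ?_) (subset_closing _ _)))
    exact hG.2 _ hK.1.compl
  · have hA' := (hν.isMaxPerSolution_iff hε).1 hA
    rw [upperRep_congr (hG.nuEquiv hA')]
    exact ⟨hA'.nuEquiv_closing h₀ h₁ (hdiff A), rfl⟩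
  · have hA' := (hν.isMinPerSolution_iff hε).1 hA
    rw [upperRep_congr (hK.nuEquiv hA'), lowerRep_eq_compl_upperRep_compl hA.1.1, opening_compl]
    refine ⟨?_, rfl⟩
    simpa using (hA'.nuEquiv_closing h₁ h₀ (hdiff Aᶜ)).compl
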